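/- Let $T$ be the infinite rooted dyadic tree (vertices are the finite binary words), $\partial T$ its boundary (infinite binary words, i.e. infinite paths from the root) and $\overline T=T\cup\partial T$, ordered by $\alpha\le\beta$ iff $\beta$ lies on the path from the root to $\alpha$ ($\beta$ is an initial segment of $\alpha$). For $\alpha,\beta\in\overline T$ let $d_T(\alpha\wedge\beta)\in\mathbb N\cup\{\infty\}$ be the number of their common ancestors in $\overline T$ (each point is an ancestor of itself), and equip $\overline T$ with the metric $2^{-d_T(\alpha\wedge\beta)}-\frac12\left(2^{-d_T(\alpha\wedge\alpha)}+2^{-d_T(\beta\wedge\beta)}\right)$. Let $\overline T^d$ be the product of $d$ copies $\overline T_1,\dots,\overline T_d$ of $\overline T$, with the coordinatewise order, the sum metric and its Borel sets; $T^d\subset\overline T^d$ is the set of its vertices (all coordinates in $T$) and $(\partial T)^d$ its distinguished boundary. Let $\pi:T^d\to(0,\infty)$ be a weight. For $f:T^d\to[0,\infty]$ and a Borel measure $\mu\ge0$ on $\overline T^d$ put, for $\alpha\in\overline T^d$ and $\beta\in T^d$, $$(\mathbb I f)(\alpha)=\sum_{\gamma\in T^d,\ \gamma\ge\alpha}f(\gamma)\pi(\gamma),\qquad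 (\mathbb I^*\mu)(\beta)=\mu\{\alpha\in\overline T^d:\alpha\le\beta\},$$ $$\mathbb V_\pi^\mu=\mathbb I(\mathbb I^*\mu),\qquad \mathcal E_\pi[\mu]=\int_{\overline T^d}\mathbb V_\pi^\mu\,d\mu,$$ $$\mathrm{cap}_\pi E=\inf\Big\{\sum_{\beta\in T^d}f(\beta)^2\pi(\beta):\ f\ge0,\ \mathbb I f\ge1\text{ on }E\Big\},\quad E\subset\overline T^d.$$ For a weight $\pi_j$ on the single tree $T_j$, $\mathrm{cap}_{\pi_j}$ is defined in the same way for subsets of $\overline T_j$. A property holds q.a.e. on $E$ if it holds at all points of $E$ outside a set of $\mathrm{cap}_\pi$-capacity zero. Assume that $\pi$ is bounded away from zero, i.e. $\inf_{T^d}\pi>0$. Then the following hold. (1) If $\mu\ge0$ is a Borel measure on $(\partial T)^d$ with $\mathcal E_\pi[\mu]<\infty$, then $\mu\big(\{\omega_j\}\times\prod_{k\ne j}\partial T_k\big)=0$ for all $1\le j\le d$ and $\omega_j\in\partial T_j$ (with $\omega_j$ in the $j$-th coordinate). (2) Suppose that $\pi$ is a product weight, $\pi(\beta)=\prod_{j=1}^d\pi_j(\beta_j)$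 with weights $\pi_j$ on $T_j$. Let $E\subset\overline T^d$ be a Borel set and let $E_j\subset\overline T_j$ be its coordinate projections. Then $\mathrm{cap}_\pi E\le\prod_{j=1}^d\mathrm{cap}_{\pi_j}E_j$. If $E$ is a product set, $E=E_1\times\dots\times E_d$, then equality holds. (3) Let $E\subset\overline T^d$ be a Borel set and $\mu\ge0$ a Borel measure on $\overline T^d$ such that $\mathcal E_\pi[\mu]<\infty$ and $\mathbb V_\pi^\mu\le1$ q.a.e. on $E$. Then $\mathrm{cap}_\pi E\ge\mu(E)$. (4) Let $E\subset\overline T^d$ be a Borel set and $\mu\ge0$ a finite Borel measure on $\overline T^d$ such that $\mu(E)\ge\mathcal E_\pi[\mu]$. Then $\mathrm{cap}_\pi E\ge\mu(E)$. -/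

import Mathlib

open scoped ENNReal NNReal
open MeasureTheory

/-- Vertices of the rooted dyadic tree `T`: finite binary words. The root is the empty word and
the two children of a word are obtained by appending one letter. -/
abbrev Vertex : Type := List Bool

/-- The closed dyadic tree `T ∪ ∂T`. A boundary point is an infinite directed path from the root,
encoded by the infinite sequence of its left/right choices. -/
inductive ClosedTree : Type
  | vertex (w : Vertex) : ClosedTree
  | boundary (ω : ℕ → Bool) : ClosedTree

namespace ClosedTree

/-- The `i`-th letter of a finite or infinite word (`none` past the end of a finite word). -/
def letter : ClosedTree → ℕ → Option Bool
  | vertex w, i => w[i]?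
  | boundary ω, i => some (ω i)

/-- `x ≤ y` if and only if `y` lies on the path from the root to `x`, i.e. the word `y` is an
initial segment of the word `x`. So the root is the largest element. -/
instance : LE ClosedTree :=
  ⟨fun x y => ∀ i b, y.letter i = some b → x.letter i = some b⟩

/-- The predecessor set: all ancestors of `x` in `T ∪ ∂T`, including `x` itself. -/
def pred (x : ClosedTree) : Set ClosedTree := {y | x ≤ y}

/-- The (possibly infinite) number of common ancestors of `x` and `y`. -/
noncomputable def commonCount (x y : ClosedTree) : ℕ∞ := (pred x ∩ pred y).encard

/-- `2 ^ (-n)`, with `2 ^ (-∞) = 0`. -/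
noncomputable def twoPowNeg (n : ℕ∞) : ℝ := if n = ⊤ then 0 else (1 / 2 : ℝ) ^ n.toNat

/-- The distance `2 ^ (-d(x ∧ y)) - (2 ^ (-d(x ∧ x)) + 2 ^ (-d(y ∧ y))) / 2` on `T ∪ ∂T`, where
`d(x ∧ y)` is the number of common ancestors of `x` and `y`. -/
noncomputable def treeDist (x y : ClosedTree) : ℝ :=
  twoPowNeg (commonCount x y)
    - (1 / 2) * (twoPowNeg (commonCount x x) + twoPowNeg (commonCount y y))

theorem twoPowNeg_anti {m n : ℕ∞} (h : m ≤ n) : twoPowNeg n ≤ twoPowNeg m := by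
  unfold twoPowNeg
  by_cases hn : n = ⊤
  · rw [if_pos hn]
    split_ifs
    · exact le_rfl
    · positivity
  · have hm : m ≠ ⊤ := fun e => hn (top_le_iff.mp (e ▸ h))
    rw [if_neg hn, if_neg hm]
    exact pow_le_pow_of_le_one (by norm_num) (by norm_num) (ENat.toNat_le_toNat h hn)

theorem twoPowNeg_inj {m n : ℕ∞} (h : twoPowNeg m = twoPowNeg n) : m = n := by
  unfold twoPowNeg at h
  by_cases hm : m = ⊤ <;> by_cases hn : n = ⊤
  · rw [hm, hn]
  · rw [if_pos hm, if_neg hn] at h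
    exact absurd h.symm (by positivity)
  · rw [if_neg hm, if_pos hn] at h
    exact absurd h (by positivity)
  · rw [if_neg hm, if_neg hn] at h
    have := pow_right_injective₀ (a := (1 / 2 : ℝ)) (by norm_num) (by norm_num) h
    rw [← ENat.natCast_toNat hm, ← ENat.natCast_toNat hn, this]

theorem le_refl_aux (x : ClosedTree) : x ≤ x := fun _ _ h => h

theorem le_trans_aux {x y z : ClosedTree} (h : x ≤ y) (k : y ≤ z) : x ≤ z :=
  fun i b e => h i b (k i b e)

theorem letter_injective : Function.Injective letter := by
  intro x y h
  cases x with
  | vertex v =>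
    cases y with
    | vertex w =>
      congr 1
      exact List.ext_getElem? fun i => congrFun h i
    | boundary ω =>
      have := congrFun h v.length
      simp [letter] at this
  | boundary ω =>
    cases y with
    | vertex w =>
      have := congrFun h w.length
      simp [letter] at this
    | boundary ω' =>
      congr 1
      funext i
      have := congrFun h i
      simpa [letter] using this

theorem le_antisymm_aux {x y : ClosedTree} (h : x ≤ y) (k : y ≤ x) : x = y := by
  apply letter_injective
  funext i
  exact Option.ext fun b => ⟨fun e => k i b e, fun e => h i b e⟩

theorem letter_isSome_mono (x : ClosedTree) {i j : ℕ} (hij : i ≤ j)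
    (h : (x.letter j).isSome) : (x.letter i).isSome := by
  cases x with
  | vertex w =>
    simp only [letter, isSome_getElem?] at h ⊢
    omega
  | boundary ω => rfl

theorem chain_aux {x a b : ClosedTree} (ha : x ≤ a) (hb : x ≤ b) : a ≤ b ∨ b ≤ a := by
  by_contra hcon
  rw [not_or] at hcon
  obtain ⟨h1, h2⟩ := hcon
  have key : ∀ {u v : ClosedTree}, x ≤ u → x ≤ v → ¬ u ≤ v →
      ∃ i, (v.letter i).isSome ∧ ¬ (u.letter i).isSome := by
    intro u v hu hv h
    by_contra hc
    push Not at hc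
    apply h
    intro i c e
    obtain ⟨c', hc'⟩ := Option.isSome_iff_exists.mp (hc i (by rw [e]; rfl))
    have e1 := hv i c e
    have e2 := hu i c' hc'
    rw [hc', ← e2, e1]
  obtain ⟨i, hi1, hi2⟩ := key ha hb h1
  obtain ⟨j, hj1, hj2⟩ := key hb ha h2
  rcases le_total i j with hij | hij
  · exact hi2 (letter_isSome_mono a hij hj1)
  · exact hj2 (letter_isSome_mono b hij hi1)

theorem commonCount_comm (x y : ClosedTree) : commonCount x y = commonCount y x := by
  unfold commonCount
  rw [Set.inter_comm]

theorem commonCount_le_left (x y : ClosedTree) : commonCount x y ≤ commonCount x x := by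
  unfold commonCount
  exact Set.encard_le_encard (by rw [Set.inter_self]; exact Set.inter_subset_left)

theorem commonCount_le_right (x y : ClosedTree) : commonCount x y ≤ commonCount y y := by
  rw [commonCount_comm]
  exact commonCount_le_left y x

theorem commonCount_ultra (x y z : ClosedTree) :
    commonCount x y ≤ commonCount x z ∨ commonCount y z ≤ commonCount x z := by
  by_cases h : pred x ∩ pred y ⊆ pred y ∩ pred z
  · left
    exact Set.encard_le_encard fun a ha => ⟨ha.1, (h ha).2⟩
  · right
    obtain ⟨a, ha, hna⟩ := Set.not_subset.mp h
    refine Set.encard_le_encard fun b hb => ⟨?_, hb.2⟩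
    rcases chain_aux ha.2 hb.1 with hab | hba
    · exact le_trans_aux ha.1 hab
    · exact absurd ⟨ha.2, le_trans_aux hb.2 hba⟩ hna

theorem finite_words (x : ClosedTree) (n : ℕ) :
    {y : ClosedTree | y ∈ pred x ∧ ¬ (y.letter n).isSome}.Finite := by
  have hf : ((fun w : Vertex => vertex w) '' {w : Vertex | w.length ≤ n}).Finite :=
    (List.finite_length_le Bool n).image _
  refine hf.subset ?_
  rintro y ⟨-, hy⟩
  cases y with
  | vertex w =>
    refine ⟨w, ?_, rfl⟩
    simp only [letter, isSome_getElem?] at hy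
    simp only [Set.mem_ofPred_eq]
    omega
  | boundary ω => exact absurd rfl hy

theorem eq_of_commonCount_top {x y : ClosedTree} (h : commonCount x y = ⊤) : x = y := by
  by_contra hne
  obtain ⟨n, hn⟩ := Function.ne_iff.mp (fun e => hne (letter_injective e))
  have hfin : (pred x ∩ pred y).Finite := by
    refine (finite_words x n).subset ?_
    rintro a ⟨hax, hay⟩
    refine ⟨hax, fun hs => ?_⟩
    obtain ⟨b, hb⟩ := Option.isSome_iff_exists.mp hs
    exact hn ((hax n b hb).trans (hay n b hb).symm)
  exact hfin.encard_lt_top.ne h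

theorem treeDist_nonneg_aux (x y : ClosedTree) :
    twoPowNeg (commonCount x x) ≤ twoPowNeg (commonCount x y) ∧
      twoPowNeg (commonCount y y) ≤ twoPowNeg (commonCount x y) :=
  ⟨twoPowNeg_anti (commonCount_le_left x y), twoPowNeg_anti (commonCount_le_right x y)⟩

theorem eq_of_treeDist_eq_zero {x y : ClosedTree} (h : treeDist x y = 0) : x = y := by
  obtain ⟨h1, h2⟩ := treeDist_nonneg_aux x y
  unfold treeDist at h
  have e1 : commonCount x x = commonCount x y := twoPowNeg_inj (by linarith)
  have e2 : commonCount y y = commonCount x y := twoPowNeg_inj (by linarith)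
  by_cases ht : commonCount x y = ⊤
  · exact eq_of_commonCount_top ht
  · have hfin : (pred x ∩ pred y).Finite := Set.encard_ne_top_iff.mp ht
    unfold commonCount at e1 e2
    rw [Set.inter_self] at e1 e2
    have f1 : pred x ∩ pred y = pred x :=
      hfin.eq_of_subset_of_encard_le Set.inter_subset_left e1.le
    have f2 : pred x ∩ pred y = pred y :=
      hfin.eq_of_subset_of_encard_le Set.inter_subset_right e2.le
    have g1 : x ∈ pred x ∩ pred y := by rw [f1]; exact le_refl_aux x
    have g2 : y ∈ pred x ∩ pred y := by rw [f2]; exact le_refl_aux y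
    exact le_antisymm_aux g2.1 g1.2

/-- `treeDist` is a metric; it is the metric with which `T ∪ ∂T` is equipped. -/
noncomputable instance : MetricSpace ClosedTree where
  dist := treeDist
  dist_self x := by
    unfold treeDist
    ring
  dist_comm x y := by
    unfold treeDist
    rw [commonCount_comm]
    ring
  dist_triangle x y z := by
    obtain ⟨h1, h2⟩ := treeDist_nonneg_aux x y
    obtain ⟨h3, h4⟩ := treeDist_nonneg_aux y z
    unfold treeDist
    rcases commonCount_ultra x y z with h | h
    · have := twoPowNeg_anti h
      linarith
    · have := twoPowNeg_anti h
      linarith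
  eq_of_dist_eq_zero h := eq_of_treeDist_eq_zero h

end ClosedTree

/-- Vertices of the `d`-tree `T^d`. -/
abbrev DVertex (d : ℕ) : Type := Fin d → Vertex

/-- The closed `d`-tree `(T ∪ ∂T)^d`. It is equipped with the coordinatewise order and the sum of
the coordinate metrics. -/
def ClosedDTree (d : ℕ) : Type := Fin d → ClosedTree

namespace ClosedDTree

variable {d : ℕ}

instance : LE (ClosedDTree d) := ⟨fun α β => ∀ j, α j ≤ β j⟩

/-- The inclusion of the vertices of `T^d` in the closed `d`-tree. -/
def vertex (β : DVertex d) : ClosedDTree d := fun j => ClosedTree.vertex (β j)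

noncomputable instance : MetricSpace (ClosedDTree d) where
  dist α β := ∑ j, dist (α j) (β j)
  dist_self α := by simp
  dist_comm α β := by simp only [dist_comm]
  dist_triangle α β γ := by
    rw [← Finset.sum_add_distrib]
    exact Finset.sum_le_sum fun j _ => dist_triangle _ _ _
  eq_of_dist_eq_zero {α β} h := by
    funext j
    exact dist_eq_zero.mp
      ((Finset.sum_eq_zero_iff_of_nonneg fun _ _ => dist_nonneg).mp h j (Finset.mem_univ j))

/-- Measurable sets of the closed `d`-tree are the Borel sets of its metric. -/
noncomputable instance : MeasurableSpace (ClosedDTree d) := borel (ClosedDTree d)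

instance : BorelSpace (ClosedDTree d) := ⟨rfl⟩

/-- The distinguished boundary `(∂T)^d`. -/
def distinguishedBoundary (d : ℕ) : Set (ClosedDTree d) :=
  {α | ∀ j, ∃ ω, α j = ClosedTree.boundary ω}

/-- The slice `{ω} × ∏_{k ≠ j} ∂T_k` of the distinguished boundary, with `ω` in the
`j`-th coordinate. -/
def boundarySlice (j : Fin d) (ω : ℕ → Bool) : Set (ClosedDTree d) :=
  {α | α j = ClosedTree.boundary ω ∧ ∀ k, k ≠ j → ∃ ω', α k = ClosedTree.boundary ω'}

/-- The projection of `E` to the `j`-th coordinate tree. -/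
def proj (j : Fin d) (E : Set (ClosedDTree d)) : Set ClosedTree :=
  {x | ∃ α ∈ E, α j = x}

/-- The product set `F_1 × ⋯ × F_d`. -/
def prodSet (F : Fin d → Set ClosedTree) : Set (ClosedDTree d) := {α | ∀ j, α j ∈ F j}

end ClosedDTree

/-- The Hardy operator `(𝕀 f)(α) = ∑_{γ ≥ α} f(γ) π(γ)`, the sum being over vertices `γ`. It is
used with `X` the closed tree or the closed `d`-tree, and `emb` the inclusion of the vertices. -/
noncomputable def hardy {V X : Type} [LE X] (emb : V → X) (π : V → ℝ≥0) (f : V → ℝ≥0∞) (α : X) :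
    ℝ≥0∞ :=
  ∑' γ : {γ : V // α ≤ emb γ}, f γ * π γ

/-- The capacity `inf {∫ f² dπ : f ≥ 0, 𝕀 f ≥ 1 on E}`. -/
noncomputable def capacity {V X : Type} [LE X] (emb : V → X) (π : V → ℝ≥0) (E : Set X) : ℝ≥0∞ :=
  ⨅ (f : V → ℝ≥0∞) (_ : ∀ α ∈ E, 1 ≤ hardy emb π f α), ∑' β, f β ^ 2 * π β

/-- The capacity of a subset of the closed dyadic tree. -/
noncomputable def treeCap (π : Vertex → ℝ≥0) (E : Set ClosedTree) : ℝ≥0∞ :=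
  capacity ClosedTree.vertex π E

/-- The capacity of a subset of the closed `d`-tree. -/
noncomputable def dtreeCap {d : ℕ} (π : DVertex d → ℝ≥0) (E : Set (ClosedDTree d)) : ℝ≥0∞ :=
  capacity ClosedDTree.vertex π E

/-- The dual Hardy operator `(𝕀* μ)(β) = μ(𝒮(β))`, with `𝒮(β)` the set of successors of `β`. -/
noncomputable def dualHardy {d : ℕ} (μ : Measure (ClosedDTree d)) (β : DVertex d) : ℝ≥0∞ :=
  μ {α | α ≤ ClosedDTree.vertex β}

/-- The potential `𝕍_π^μ = 𝕀 (𝕀* μ)`. -/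
noncomputable def potential {d : ℕ} (π : DVertex d → ℝ≥0) (μ : Measure (ClosedDTree d))
    (α : ClosedDTree d) : ℝ≥0∞ :=
  hardy ClosedDTree.vertex π (dualHardy μ) α

/-- The energy `∫ 𝕍_π^μ dμ`. -/
noncomputable def energy {d : ℕ} (π : DVertex d → ℝ≥0) (μ : Measure (ClosedDTree d)) : ℝ≥0∞ :=
  ∫⁻ α, potential π μ α ∂μ

/-- The property `P` holds quasi-almost everywhere on `E`: everywhere on `E` except on a set of
capacity zero. -/
def QAEOn {d : ℕ} (π : DVertex d → ℝ≥0) (E : Set (ClosedDTree d)) (P : ClosedDTree d → Prop) :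
    Prop :=
  ∃ N : Set (ClosedDTree d), dtreeCap π N = 0 ∧ ∀ α ∈ E, α ∉ N → P α

/-! Parts (1), (3) and (4) rest on duality. Integrating `𝕀 f` against `μ` gives `∑ f · 𝕀*μ · π`, by
Tonelli and the fact that successor sets are Borel; with `f = 𝕀*μ` the energy is `∑ (𝕀*μ)² π`. If `𝕀
f ≥ 1` on `E`, Cauchy–Schwarz gives `μ(E)² ≤ (∑ f² π) · energy`, so `μ(E)² / energy ≤ cap E`
(`measure_sq_div_energy_le_dtreeCap`). Part (4) is immediate from this. It also shows that a measure
of finite energy ignores sets of capacity zero, so in (3) the restriction of `μ` to `E` has energy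
at most `μ(E)`, and (4) applies to it. For (1), a slice of mass `m > 0` would contribute at least
`m² inf π` to the energy at infinitely many vertices.

Part (2) needs no measures. Tensor products of admissible functions give `≤` for product sets
(`capacity_prod_le`). Conversely, let `f` be admissible for `E × F`. Applying `𝕀` in the first
variable at a point of `E` leaves a function admissible for `F`; by Minkowski, the `ℓ²(π₂)` norms of
the sections of `f`, divided by `(cap F)^(1/2)`, are then admissible for `E` (`le_capacity_prod`).
Induction on `d` follows, and a general `E` lies in the product of its projections. -/

/-! ### Cauchy–Schwarz and Minkowski for weighted sums -/

section Sums

variable {ι V : Type*}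

/-- The Cauchy–Schwarz inequality for sums with a weight. -/
theorem tsum_mul_mul_le_rpow_mul_rpow (w f g : V → ℝ≥0∞) :
    ∑' v, f v * g v * w v ≤
      (∑' v, f v ^ 2 * w v) ^ (1 / 2 : ℝ) * (∑' v, g v ^ 2 * w v) ^ (1 / 2 : ℝ) := by
  let _ : MeasurableSpace V := ⊤
  have hsq : ∀ x : ℝ≥0∞, x ^ (1 / 2 : ℝ) * x ^ (1 / 2 : ℝ) = x := fun x => by
    rw [← ENNReal.rpow_add_of_nonneg _ _ (by norm_num) (by norm_num)]; norm_num
  -- Hölder for counting measure, with the weight split evenly as `w^(1/2) · w^(1/2)`.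
  have h := ENNReal.lintegral_mul_le_Lp_mul_Lq (μ := (Measure.count : Measure V))
    (p := 2) (q := 2) (Real.HolderConjugate.two_two)
    (f := fun v => f v * w v ^ (1 / 2 : ℝ)) (g := fun v => g v * w v ^ (1 / 2 : ℝ))
    measurable_from_top.aemeasurable measurable_from_top.aemeasurable
  simp only [Pi.mul_apply, lintegral_count, ENNReal.rpow_ofNat, mul_pow] at h
  convert h using 1
  · exact tsum_congr fun v => by rw [mul_mul_mul_comm, hsq]
  · simp only [pow_two (_ ^ (1 / 2 : ℝ)), hsq]

/-- Minkowski's inequality for weighted sums. -/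
theorem tsum_tsum_mul_sq_le (u : ι → ℝ≥0∞) (w : V → ℝ≥0∞) (h : ι → V → ℝ≥0∞) :
    ∑' v, (∑' i, u i * h i v) ^ 2 * w v ≤
      (∑' i, u i * (∑' v, h i v ^ 2 * w v) ^ (1 / 2 : ℝ)) ^ 2 := by
  calc ∑' v, (∑' i, u i * h i v) ^ 2 * w v
      -- Expand the square; Cauchy–Schwarz on each pair `(i, k)` leaves a double sum that is again a
      -- square.
      = ∑' v, ∑' i, ∑' k, u i * u k * (h i v * h k v * w v) := by
        refine tsum_congr fun v => ?_
        rw [pow_two, mul_assoc, ← ENNReal.tsum_mul_right]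
        refine tsum_congr fun i => ?_
        rw [← ENNReal.tsum_mul_right, ← ENNReal.tsum_mul_left]
        exact tsum_congr fun k => by ring
    _ = ∑' i, ∑' k, u i * u k * ∑' v, h i v * h k v * w v := by
        rw [ENNReal.tsum_comm]
        refine tsum_congr fun i => ?_
        rw [ENNReal.tsum_comm]
        exact tsum_congr fun k => ENNReal.tsum_mul_left
    _ ≤ ∑' i, ∑' k, u i * u k * ((∑' v, h i v ^ 2 * w v) ^ (1 / 2 : ℝ) *
          (∑' v, h k v ^ 2 * w v) ^ (1 / 2 : ℝ)) := by
        gcongr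
        exact tsum_mul_mul_le_rpow_mul_rpow _ _ _
    _ = _ := by
        rw [pow_two, ← ENNReal.tsum_mul_right]
        refine tsum_congr fun i => ?_
        rw [← ENNReal.tsum_mul_left]
        exact tsum_congr fun k => by ring

theorem rpow_half_sq (x : ℝ≥0∞) : (x ^ (1 / 2 : ℝ)) ^ 2 = x := by
  rw [← ENNReal.rpow_natCast, ← ENNReal.rpow_mul]
  norm_num

end Sums

/-! ### Capacities of products of two ordered sets -/

section Capacity

variable {V W X Y : Type} [LE X] [LE Y]

theorem hardy_eq_tsum_indicator (emb : V → X) (π : V → ℝ≥0) (f : V → ℝ≥0∞) (α : X) :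
    hardy emb π f α =
      ∑' γ, Set.indicator {γ | α ≤ emb γ} (1 : V → ℝ≥0∞) γ * (f γ * π γ) := by
  unfold hardy
  refine (tsum_subtype {γ | α ≤ emb γ} (fun γ => f γ * (π γ : ℝ≥0∞))).trans (tsum_congr fun γ => ?_)
  by_cases h : α ≤ emb γ <;> simp [Set.indicator, h]

theorem capacity_le {emb : V → X} {π : V → ℝ≥0} {E : Set X} {f : V → ℝ≥0∞}
    (hf : ∀ α ∈ E, 1 ≤ hardy emb π f α) : capacity emb π E ≤ ∑' β, f β ^ 2 * π β :=
  iInf₂_le f hf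

theorem capacity_mono (emb : V → X) (π : V → ℝ≥0) {E F : Set X} (h : E ⊆ F) :
    capacity emb π E ≤ capacity emb π F :=
  le_iInf₂ fun _ hf => capacity_le fun α hα => hf α (h hα)

/-- A mass `1/π(r)` at the root alone is admissible for every set. -/
theorem capacity_ne_top {emb : V → X} {π : V → ℝ≥0} {r : V} (hr : ∀ α, α ≤ emb r)
    (hπ : π r ≠ 0) (E : Set X) : capacity emb π E ≠ ∞ := by
  classical
  set f : V → ℝ≥0∞ := Pi.single r (π r : ℝ≥0∞)⁻¹ with hf
  have hπ' : (π r : ℝ≥0∞) ≠ 0 := by simpa using hπ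
  have hadm : ∀ α ∈ E, 1 ≤ hardy emb π f α := by
    intro α _
    refine le_trans (le_of_eq ?_)
      (ENNReal.le_tsum (f := fun γ : {γ : V // α ≤ emb γ} => f γ * (π γ : ℝ≥0∞)) ⟨r, hr α⟩)
    simp [hf, ENNReal.inv_mul_cancel hπ']
  refine ne_top_of_le_ne_top ?_ (capacity_le hadm)
  rw [tsum_eq_single r (fun b hb => by simp [hf, hb])]
  simp only [hf, Pi.single_eq_same]
  exact ENNReal.mul_ne_top (ENNReal.pow_ne_top (ENNReal.inv_ne_top.mpr hπ')) ENNReal.coe_ne_top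

theorem capacity_equiv {emb : V → X} {emb' : W → Y} {π : V → ℝ≥0} {π' : W → ℝ≥0}
    (eV : V ≃ W) (eX : X ≃ Y) (hle : ∀ x v, eX x ≤ emb' (eV v) ↔ x ≤ emb v)
    (hπ : ∀ v, π' (eV v) = π v) {E : Set X} {E' : Set Y} (hE : ∀ x, eX x ∈ E' ↔ x ∈ E) :
    capacity emb' π' E' = capacity emb π E := by
  have key : ∀ f x, hardy emb' π' f (eX x) = hardy emb π (f ∘ eV) x := by
    intro f x
    rw [hardy_eq_tsum_indicator, hardy_eq_tsum_indicator, ← eV.tsum_eq]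
    refine tsum_congr fun v => ?_
    by_cases h : x ≤ emb v <;> simp [hπ, Set.indicator, hle, h]
  apply le_antisymm
  · refine le_iInf₂ fun f hf => ?_
    refine (capacity_le (f := f ∘ eV.symm) ?_).trans (le_of_eq ?_)
    · intro y hy
      obtain ⟨x, rfl⟩ := eX.surjective y
      rw [key, Function.comp_assoc, eV.symm_comp_self, Function.comp_id]
      exact hf x ((hE x).mp hy)
    · rw [← eV.tsum_eq]
      simp [hπ]
  · refine le_iInf₂ fun f hf => ?_
    refine (capacity_le (f := f ∘ eV) ?_).trans (le_of_eq ?_)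
    · intro x hx
      rw [← key]
      exact hf _ ((hE x).mpr hx)
    · rw [← eV.tsum_eq (fun w => f w ^ 2 * (π' w : ℝ≥0∞))]
      simp [hπ]

/-- Tonelli: the indicator of the product order and the product weight both factor. -/
theorem hardy_prod (e₁ : V → X) (e₂ : W → Y) (π₁ : V → ℝ≥0) (π₂ : W → ℝ≥0)
    (f : V × W → ℝ≥0∞) (x : X) (y : Y) :
    hardy (Prod.map e₁ e₂) (fun p => π₁ p.1 * π₂ p.2) f (x, y) =
      hardy e₂ π₂ (fun w => hardy e₁ π₁ (fun v => f (v, w)) x) y := by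
  simp only [hardy_eq_tsum_indicator]
  rw [ENNReal.tsum_prod', ENNReal.tsum_comm]
  refine tsum_congr fun w => ?_
  rw [← ENNReal.tsum_mul_right, ← ENNReal.tsum_mul_left]
  refine tsum_congr fun v => ?_
  by_cases h₁ : x ≤ e₁ v <;> by_cases h₂ : y ≤ e₂ w <;>
    simp [Set.indicator, h₁, h₂, Prod.mk_le_mk, mul_assoc]

theorem hardy_const_mul (emb : V → X) (π : V → ℝ≥0) (c : ℝ≥0∞) (f : V → ℝ≥0∞) (α : X) :
    hardy emb π (fun v => c * f v) α = c * hardy emb π f α := by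
  unfold hardy
  rw [← ENNReal.tsum_mul_left]
  exact tsum_congr fun v => by ring

/-- The capacity of a product set for a product weight, upper bound. -/
theorem capacity_prod_le (e₁ : V → X) (e₂ : W → Y) (π₁ : V → ℝ≥0) (π₂ : W → ℝ≥0)
    {E : Set X} {F : Set Y} (hE : capacity e₁ π₁ E ≠ ∞) (hF : capacity e₂ π₂ F ≠ ∞) :
    capacity (Prod.map e₁ e₂) (fun p => π₁ p.1 * π₂ p.2) (E ×ˢ F) ≤
      capacity e₁ π₁ E * capacity e₂ π₂ F := by
  have key : ∀ f₁ f₂, (∀ x ∈ E, 1 ≤ hardy e₁ π₁ f₁ x) → (∀ y ∈ F, 1 ≤ hardy e₂ π₂ f₂ y) →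
      capacity (Prod.map e₁ e₂) (fun p => π₁ p.1 * π₂ p.2) (E ×ˢ F) ≤
        (∑' v, f₁ v ^ 2 * π₁ v) * ∑' w, f₂ w ^ 2 * π₂ w := by
    intro f₁ f₂ h₁ h₂
    refine (capacity_le (f := fun p => f₁ p.1 * f₂ p.2) ?_).trans (le_of_eq ?_)
    · rintro ⟨x, y⟩ ⟨hx, hy⟩
      rw [hardy_prod]
      simp only [mul_comm (f₁ _), hardy_const_mul]
      simp only [mul_comm (f₂ _), hardy_const_mul]
      exact one_le_mul (h₁ x hx) (h₂ y hy)
    · rw [ENNReal.tsum_prod', ← ENNReal.tsum_mul_right]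
      refine tsum_congr fun v => ?_
      rw [← ENNReal.tsum_mul_left]
      refine tsum_congr fun w => ?_
      push_cast
      ring
  refine ENNReal.le_of_forall_pos_le_add fun ε hε _ => ?_
  -- Near-minimizers with error `t` suffice: multiplication is continuous here because both
  -- capacities are finite.
  have hcont : Filter.Tendsto (fun t : ℝ≥0∞ => (capacity e₁ π₁ E + t) * (capacity e₂ π₂ F + t))
      (nhds 0) (nhds (capacity e₁ π₁ E * capacity e₂ π₂ F)) := by
    have a := (continuous_const_add (capacity e₁ π₁ E)).tendsto (0 : ℝ≥0∞)
    have b := (continuous_const_add (capacity e₂ π₂ F)).tendsto (0 : ℝ≥0∞)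
    rw [add_zero] at a b
    exact ENNReal.Tendsto.mul a (Or.inr hF) b (Or.inr hE)
  have hlt : capacity e₁ π₁ E * capacity e₂ π₂ F < capacity e₁ π₁ E * capacity e₂ π₂ F + ε :=
    ENNReal.lt_add_right (ENNReal.mul_ne_top hE hF) (by simpa using hε.ne')
  have hev := (hcont.eventually (gt_mem_nhds hlt))
  obtain ⟨t, ht, ht0⟩ := ((hev.filter_mono nhdsWithin_le_nhds).and
    (self_mem_nhdsWithin (s := Set.Ioi (0 : ℝ≥0∞)))).exists
  have exadm : ∀ {V X : Type} [LE X] (e : V → X) (π : V → ℝ≥0) (E : Set X),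
      capacity e π E ≠ ∞ → ∃ f : V → ℝ≥0∞, (∀ x ∈ E, 1 ≤ hardy e π f x) ∧
        ∑' v, f v ^ 2 * (π v : ℝ≥0∞) < capacity e π E + t := by
    intro V X _ e π E h
    have := ENNReal.lt_add_right h (ne_of_gt ht0)
    nth_rewrite 1 [capacity] at this
    simpa only [iInf_lt_iff, exists_prop] using this
  obtain ⟨f₁, h₁, h₁'⟩ := exadm e₁ π₁ E hE
  obtain ⟨f₂, h₂, h₂'⟩ := exadm e₂ π₂ F hF
  exact (key f₁ f₂ h₁ h₂).trans ((mul_le_mul' h₁'.le h₂'.le).trans ht.le)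

/-- The capacity of a product set for a product weight, lower bound. -/
theorem le_capacity_prod (e₁ : V → X) (e₂ : W → Y) (π₁ : V → ℝ≥0) (π₂ : W → ℝ≥0)
    {E : Set X} {F : Set Y} (hF : capacity e₂ π₂ F ≠ ∞) :
    capacity e₁ π₁ E * capacity e₂ π₂ F ≤
      capacity (Prod.map e₁ e₂) (fun p => π₁ p.1 * π₂ p.2) (E ×ˢ F) := by
  rcases eq_or_ne (capacity e₂ π₂ F) 0 with h0 | h0
  · simp [h0]
  refine le_iInf₂ fun f hf => ?_
  set c := capacity e₂ π₂ F with hc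
  set g : V → ℝ≥0∞ := fun v => (∑' w, f (v, w) ^ 2 * π₂ w) ^ (1 / 2 : ℝ) with hg
  have hcg : ∀ x ∈ E, c ≤ hardy e₁ π₁ g x ^ 2 := by
    intro x hx
    refine (capacity_le (f := fun w => hardy e₁ π₁ (fun v => f (v, w)) x) ?_).trans ?_
    · intro y hy
      rw [← hardy_prod]
      exact hf (x, y) ⟨hx, hy⟩
    · simp only [hardy_eq_tsum_indicator]
      -- Minkowski over the first-tree vertices `v`, with coefficients `1_{x ≤ v} π₁(v)`.
      have h := tsum_tsum_mul_sq_le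
        (fun v => Set.indicator {γ | x ≤ e₁ γ} (1 : V → ℝ≥0∞) v * π₁ v)
        (fun w => (π₂ w : ℝ≥0∞)) (fun v w => f (v, w))
      simpa only [hg, mul_assoc, mul_comm, mul_left_comm] using h
  have hc' : c ^ (1 / 2 : ℝ) ≠ 0 := by simpa [ENNReal.rpow_eq_zero_iff] using h0
  have hc'' : c ^ (1 / 2 : ℝ) ≠ ∞ := ENNReal.rpow_ne_top_of_nonneg (by norm_num) hF
  have hcap := capacity_le (emb := e₁) (π := π₁) (E := E)
    (f := fun v => (c ^ (1 / 2 : ℝ))⁻¹ * g v) (by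
      intro x hx
      rw [hardy_const_mul, mul_comm, ← div_eq_mul_inv, ENNReal.le_div_iff_mul_le (Or.inl hc')
        (Or.inl hc''), one_mul]
      have := ENNReal.rpow_le_rpow (hcg x hx) (z := 1 / 2) (by norm_num)
      rwa [← ENNReal.rpow_natCast (hardy e₁ π₁ g x) 2, ← ENNReal.rpow_mul,
        show ((2 : ℕ) : ℝ) * (1 / 2) = 1 by norm_num, ENNReal.rpow_one] at this)
  have hsum : ∑' v, ((c ^ (1 / 2 : ℝ))⁻¹ * g v) ^ 2 * (π₁ v : ℝ≥0∞) =
      c⁻¹ * ∑' v, g v ^ 2 * (π₁ v : ℝ≥0∞) := by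
    rw [← ENNReal.tsum_mul_left]
    refine tsum_congr fun v => ?_
    rw [mul_pow, ← ENNReal.inv_pow, rpow_half_sq, mul_assoc]
  rw [hsum, mul_comm, ← div_eq_mul_inv, ENNReal.le_div_iff_mul_le (Or.inl h0) (Or.inl hF)] at hcap
  refine hcap.trans (le_of_eq ?_)
  rw [ENNReal.tsum_prod']
  refine tsum_congr fun v => ?_
  rw [hg, rpow_half_sq, ← ENNReal.tsum_mul_right]
  refine tsum_congr fun w => ?_
  push_cast
  ring

end Capacity

/-! ### Product weights on the `d`-tree, by induction on `d` -/

section ProductWeights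

theorem ClosedTree.le_root (x : ClosedTree) : x ≤ ClosedTree.vertex [] := by
  intro i b h
  simp [ClosedTree.letter] at h

theorem dtreeCap_prodSet_succ {d : ℕ} (πc : Fin (d + 1) → Vertex → ℝ≥0)
    (F : Fin (d + 1) → Set ClosedTree)
    (h₁ : treeCap (πc 0) (F 0) ≠ ∞)
    (h₂ : dtreeCap (fun β => ∏ j : Fin d, πc j.succ (β j))
      (ClosedDTree.prodSet fun j : Fin d => F j.succ) ≠ ∞) :
    dtreeCap (fun β => ∏ j, πc j (β j)) (ClosedDTree.prodSet F) =
      treeCap (πc 0) (F 0) * dtreeCap (fun β => ∏ j : Fin d, πc j.succ (β j))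
        (ClosedDTree.prodSet fun j : Fin d => F j.succ) := by
  have hprod := le_antisymm
    (capacity_prod_le ClosedTree.vertex (ClosedDTree.vertex (d := d)) (πc 0)
      (fun β => ∏ j : Fin d, πc j.succ (β j)) h₁ h₂)
    (le_capacity_prod ClosedTree.vertex (ClosedDTree.vertex (d := d)) (πc 0)
      (fun β => ∏ j : Fin d, πc j.succ (β j)) h₂)
  refine Eq.trans ?_ hprod
  refine capacity_equiv (Fin.consEquiv fun _ => Vertex)
    (show ClosedTree × ClosedDTree d ≃ ClosedDTree (d + 1) from Fin.consEquiv fun _ => ClosedTree)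
    ?_ ?_ ?_
  · rintro ⟨x, y⟩ ⟨v, w⟩
    exact Fin.forall_fin_succ
  · rintro ⟨v, w⟩
    exact Fin.prod_univ_succ _
  · rintro ⟨x, y⟩
    exact Fin.forall_fin_succ

theorem dtreeCap_prodSet {d : ℕ} (πc : Fin d → Vertex → ℝ≥0) (hπ : ∀ j v, πc j v ≠ 0)
    (F : Fin d → Set ClosedTree) :
    dtreeCap (fun β => ∏ j, πc j (β j)) (ClosedDTree.prodSet F) = ∏ j, treeCap (πc j) (F j) := by
  have hfin : ∀ {d : ℕ} (πc : Fin d → Vertex → ℝ≥0) (_ : ∀ j v, πc j v ≠ 0)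
      (E : Set (ClosedDTree d)), dtreeCap (fun β => ∏ j, πc j (β j)) E ≠ ∞ :=
    fun πc hπ E => capacity_ne_top (r := fun _ => []) (fun α j => (α j).le_root)
      (Finset.prod_ne_zero_iff.mpr fun j _ => hπ j _) E
  induction d with
  | zero =>
    -- `T^0` has one vertex and one point, of weight `1`, so the capacity is `1`, the empty product.
    refine le_antisymm ?_ (le_iInf₂ fun f hf => ?_)
    · refine (capacity_le (f := 1) ?_).trans (by simp)
      intro α _
      rw [hardy_eq_tsum_indicator]
      simp [Set.indicator, show ∀ γ, α ≤ ClosedDTree.vertex γ from fun γ j => j.elim0]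
    · have hα := hf (show ClosedDTree 0 from fun j => j.elim0) (fun j => j.elim0)
      let β : DVertex 0 := fun j => j.elim0
      have hβ : ∀ γ, γ ≠ β → False := fun γ h => h (Subsingleton.elim γ β)
      rw [hardy_eq_tsum_indicator, tsum_eq_single β fun γ h => (hβ γ h).elim] at hα
      rw [tsum_eq_single β fun γ h => (hβ γ h).elim]
      have h1 : 1 ≤ f β := by
        refine hα.trans ?_
        simp only [Finset.univ_eq_empty, Finset.prod_empty, ENNReal.coe_one, mul_one]
        exact (mul_le_mul_left (Set.indicator_le_self' (by simp) _) _).trans (by simp)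
      simpa using one_le_pow₀ h1 (n := 2)
  | succ d ih =>
    rw [dtreeCap_prodSet_succ πc F (capacity_ne_top ClosedTree.le_root (hπ 0 []) _)
      (hfin _ (fun j => hπ j.succ) _), ih _ (fun j => hπ j.succ), Fin.prod_univ_succ]

theorem dtreeCap_le_prod_proj {d : ℕ} (πc : Fin d → Vertex → ℝ≥0) (hπ : ∀ j v, πc j v ≠ 0)
    (E : Set (ClosedDTree d)) :
    dtreeCap (fun β => ∏ j, πc j (β j)) E ≤ ∏ j, treeCap (πc j) (ClosedDTree.proj j E) :=
  (capacity_mono _ _ fun α hα _ => ⟨α, hα, rfl⟩).trans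
    (dtreeCap_prodSet πc hπ fun j => ClosedDTree.proj j E).le

end ProductWeights

/-! ### Successor sets are closed -/

section Energy

theorem ClosedTree.pred_vertex_finite (w : Vertex) : (pred (vertex w)).Finite := by
  refine (finite_words (vertex w) w.length).subset fun z hz => ⟨hz, fun hs => ?_⟩
  obtain ⟨b, hb⟩ := Option.isSome_iff_exists.mp hs
  have := hz _ _ hb
  simp [letter] at this

/-- Ancestors of `x` form a chain, so one shared with `y` must be a proper ancestor of `w`;
strictness uses that `w` has finitely many ancestors. -/
theorem ClosedTree.commonCount_lt_of_not_le {w : Vertex} {x y : ClosedTree}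
    (hx : x ≤ vertex w) (hy : ¬ y ≤ vertex w) :
    commonCount x y < (pred (vertex w)).encard := by
  have hsub : pred x ∩ pred y ⊆ pred (vertex w) := by
    rintro z ⟨hzx, hzy⟩
    rcases chain_aux hx hzx with h | h
    · exact h
    · exact absurd (le_trans_aux hzy h) hy
  exact ((pred_vertex_finite w).subset hsub).encard_lt_encard
    ⟨hsub, fun h => hy (h (le_refl_aux (vertex w))).2⟩

/-- The successor set of a vertex is uniformly separated from its complement. -/
theorem ClosedTree.exists_le_dist_of_not_le (w : Vertex) :
    ∃ ε > 0, ∀ x y : ClosedTree, x ≤ vertex w → ¬ y ≤ vertex w → ε ≤ dist x y := by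
  obtain ⟨n, hn⟩ := ENat.ne_top_iff_exists.mp (pred_vertex_finite w).encard_lt_top.ne
  -- With `n` ancestors of `w` and `m < n` common ones, the distance is at least `2^(-m) - (2^(-n) +
  -- 2^(-m))/2 ≥ 2^(-n)/2`.
  refine ⟨(1 / 2) * (1 / 2 : ℝ) ^ n, by positivity, fun x y hx hy => ?_⟩
  have h1 := commonCount_lt_of_not_le hx hy
  have h2 : (pred (vertex w)).encard ≤ commonCount x x := by
    unfold commonCount
    rw [Set.inter_self]
    exact Set.encard_le_encard fun z hz => le_trans_aux hx hz
  rw [← hn] at h1 h2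
  obtain ⟨m, hm⟩ := ENat.ne_top_iff_exists.mp (ne_top_of_lt h1)
  rw [← hm] at h1
  have hmn : m + 1 ≤ n := by exact_mod_cast h1
  have e1 : twoPowNeg (commonCount x x) ≤ (1 / 2) ^ n := by
    simpa [twoPowNeg] using twoPowNeg_anti h2
  have e2 : twoPowNeg (commonCount x y) = (1 / 2) ^ m := by
    simp [← hm, twoPowNeg]
  have e3 := (treeDist_nonneg_aux x y).2
  have e4 : (1 / 2 : ℝ) ^ n ≤ (1 / 2) ^ (m + 1) :=
    pow_le_pow_of_le_one (by norm_num) (by norm_num) hmn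
  rw [pow_succ] at e4
  change _ ≤ treeDist x y
  unfold treeDist
  linarith

theorem ClosedTree.isClosed_successors (w : Vertex) : IsClosed {x : ClosedTree | x ≤ vertex w} := by
  obtain ⟨ε, hε, h⟩ := exists_le_dist_of_not_le w
  refine isClosed_of_closure_subset fun y hy => ?_
  by_contra hn
  obtain ⟨x, hx, hxy⟩ := Metric.mem_closure_iff.mp hy ε hε
  rw [dist_comm] at hxy
  exact absurd (h x y hx hn) (not_le.mpr hxy)

namespace ClosedDTree

variable {d : ℕ}

theorem continuous_eval (j : Fin d) : Continuous fun α : ClosedDTree d => α j := by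
  refine LipschitzWith.continuous (K := 1) (LipschitzWith.of_dist_le_mul fun α β => ?_)
  rw [NNReal.coe_one, one_mul]
  exact Finset.single_le_sum (f := fun j => dist (α j) (β j)) (fun _ _ => dist_nonneg)
    (Finset.mem_univ j)

theorem measurableSet_successors (β : DVertex d) : MeasurableSet {α | α ≤ vertex β} := by
  refine IsClosed.measurableSet ?_
  have : {α | α ≤ vertex β} =
      ⋂ j, (fun α : ClosedDTree d => α j) ⁻¹' {x | x ≤ ClosedTree.vertex (β j)} := by
    ext α
    simp only [Set.mem_iInter]
    rfl
  rw [this]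
  exact isClosed_iInter fun j => (ClosedTree.isClosed_successors _).preimage (continuous_eval j)

end ClosedDTree

/-! ### Duality, energy and capacity -/

variable {d : ℕ}

theorem hardy_vertex_eq_tsum (π : DVertex d → ℝ≥0) (f : DVertex d → ℝ≥0∞) (α : ClosedDTree d) :
    hardy ClosedDTree.vertex π f α =
      ∑' γ, Set.indicator {α | α ≤ ClosedDTree.vertex γ} (fun _ => f γ * π γ) α := by
  rw [hardy_eq_tsum_indicator]
  refine tsum_congr fun γ => ?_
  by_cases h : α ≤ ClosedDTree.vertex γ <;> simp [Set.indicator, h]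

theorem measurable_hardy (π : DVertex d → ℝ≥0) (f : DVertex d → ℝ≥0∞) :
    Measurable (hardy (ClosedDTree.vertex (d := d)) π f) := by
  rw [funext (hardy_vertex_eq_tsum π f)]
  exact Measurable.tsum fun γ =>
    measurable_const.indicator (ClosedDTree.measurableSet_successors γ)

/-- `𝕀` and `𝕀*` are dual to each other. -/
theorem lintegral_hardy (π : DVertex d → ℝ≥0) (f : DVertex d → ℝ≥0∞)
    (μ : Measure (ClosedDTree d)) :
    ∫⁻ α, hardy ClosedDTree.vertex π f α ∂μ = ∑' γ, f γ * dualHardy μ γ * π γ := by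
  simp only [hardy_vertex_eq_tsum]
  rw [lintegral_tsum fun γ =>
    (measurable_const.indicator (ClosedDTree.measurableSet_successors γ)).aemeasurable]
  refine tsum_congr fun γ => ?_
  rw [lintegral_indicator_const (ClosedDTree.measurableSet_successors γ), dualHardy]
  ring

theorem energy_eq_tsum (π : DVertex d → ℝ≥0) (μ : Measure (ClosedDTree d)) :
    energy π μ = ∑' γ, dualHardy μ γ ^ 2 * π γ := by
  simp only [energy, potential, lintegral_hardy, pow_two]

theorem lintegral_hardy_le (π : DVertex d → ℝ≥0) (f : DVertex d → ℝ≥0∞)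
    (μ : Measure (ClosedDTree d)) :
    ∫⁻ α, hardy ClosedDTree.vertex π f α ∂μ ≤
      (∑' γ, f γ ^ 2 * π γ) ^ (1 / 2 : ℝ) * energy π μ ^ (1 / 2 : ℝ) := by
  rw [lintegral_hardy, energy_eq_tsum]
  exact tsum_mul_mul_le_rpow_mul_rpow _ _ _

theorem measure_le_lintegral_hardy (π : DVertex d → ℝ≥0) {f : DVertex d → ℝ≥0∞}
    (μ : Measure (ClosedDTree d)) {E : Set (ClosedDTree d)}
    (hf : ∀ α ∈ E, 1 ≤ hardy ClosedDTree.vertex π f α) :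
    μ E ≤ ∫⁻ α, hardy ClosedDTree.vertex π f α ∂μ := by
  refine (measure_mono (t := {α | 1 ≤ hardy ClosedDTree.vertex π f α}) hf).trans ?_
  simpa using mul_meas_ge_le_lintegral (μ := μ) (measurable_hardy π f) 1

/-- Cauchy–Schwarz against each admissible function. The extended division is harmless: zero energy
forces `μ E = 0`, and infinite energy makes the quotient `0`. -/
theorem measure_sq_div_energy_le_dtreeCap (π : DVertex d → ℝ≥0) (μ : Measure (ClosedDTree d))
    (E : Set (ClosedDTree d)) : μ E ^ 2 / energy π μ ≤ dtreeCap π E := by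
  refine le_iInf₂ fun f hf => ENNReal.div_le_of_le_mul ?_
  calc μ E ^ 2 ≤ ((∑' γ, f γ ^ 2 * π γ) ^ (1 / 2 : ℝ) * energy π μ ^ (1 / 2 : ℝ)) ^ 2 := by
        gcongr
        exact (measure_le_lintegral_hardy π μ hf).trans (lintegral_hardy_le π f μ)
    _ = _ := by rw [mul_pow, rpow_half_sq, rpow_half_sq]

theorem measure_eq_zero_of_dtreeCap_eq_zero {π : DVertex d → ℝ≥0} {μ : Measure (ClosedDTree d)}
    (hμ : energy π μ ≠ ∞) {N : Set (ClosedDTree d)} (hN : dtreeCap π N = 0) : μ N = 0 := by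
  have h := measure_sq_div_energy_le_dtreeCap π μ N
  rw [hN, nonpos_iff_eq_zero, ENNReal.div_eq_zero_iff] at h
  exact pow_eq_zero_iff two_ne_zero |>.mp (h.resolve_right hμ)

theorem measure_le_dtreeCap_of_energy_le {π : DVertex d → ℝ≥0} {μ : Measure (ClosedDTree d)}
    {E : Set (ClosedDTree d)} (hfin : μ E ≠ ∞) (h : energy π μ ≤ μ E) : μ E ≤ dtreeCap π E := by
  rcases eq_or_ne (μ E) 0 with h0 | h0
  · simp [h0]
  calc μ E = μ E ^ 2 / μ E := by rw [pow_two, ENNReal.mul_div_cancel_right h0 hfin]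
    _ ≤ μ E ^ 2 / energy π μ := ENNReal.div_le_div_left h _
    _ ≤ dtreeCap π E := measure_sq_div_energy_le_dtreeCap π μ E

theorem hardy_mono {V X : Type} [LE X] (emb : V → X) (π : V → ℝ≥0) {f g : V → ℝ≥0∞} (h : f ≤ g) :
    hardy emb π f ≤ hardy emb π g :=
  fun _ => ENNReal.tsum_le_tsum fun γ => mul_le_mul_left (h γ) _

/-- Restricting the measure can only lower its potential. -/
theorem energy_restrict_le {π : DVertex d → ℝ≥0} {μ : Measure (ClosedDTree d)}
    {E : Set (ClosedDTree d)} (hE : MeasurableSet E)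
    (h : ∀ᵐ α ∂μ, α ∈ E → potential π μ α ≤ 1) : energy π (μ.restrict E) ≤ μ E := by
  calc energy π (μ.restrict E) ≤ ∫⁻ α in E, potential π μ α ∂μ :=
        lintegral_mono (hardy_mono _ _ fun β => Measure.restrict_apply_le _ _)
    _ ≤ ∫⁻ _ in E, 1 ∂μ := lintegral_mono_ae ((ae_restrict_iff' hE).mpr h)
    _ = μ E := by simp

/-- The root term of the energy is the squared total mass times `π` at the root. -/
theorem measure_univ_ne_top_of_energy_ne_top {π : DVertex d → ℝ≥0} {μ : Measure (ClosedDTree d)}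
    (hπ : π (fun _ => []) ≠ 0) (hμ : energy π μ ≠ ∞) : μ Set.univ ≠ ∞ := by
  intro htop
  refine hμ (top_le_iff.mp ?_)
  rw [energy_eq_tsum]
  refine le_trans (le_of_eq ?_) (ENNReal.le_tsum (fun _ => []))
  have : {α : ClosedDTree d | α ≤ ClosedDTree.vertex fun _ => []} = Set.univ :=
    Set.eq_univ_of_forall fun α j => (α j).le_root
  rw [dualHardy, this, htop]
  simp [ENNReal.top_mul, hπ]

theorem measure_le_dtreeCap_of_potential_le {π : DVertex d → ℝ≥0}
    (hπ : π (fun _ => []) ≠ 0) {μ : Measure (ClosedDTree d)} {E : Set (ClosedDTree d)}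
    (hE : MeasurableSet E) (hμ : energy π μ ≠ ∞)
    (h : QAEOn π E fun α => potential π μ α ≤ 1) : μ E ≤ dtreeCap π E := by
  obtain ⟨N, hN, hNE⟩ := h
  have hae : ∀ᵐ α ∂μ, α ∈ E → potential π μ α ≤ 1 := by
    refine measure_mono_null (fun α hα => ?_) (measure_eq_zero_of_dtreeCap_eq_zero hμ hN)
    by_contra hn
    exact hα fun hαE => hNE α hαE hn
  have hfin : μ E ≠ ∞ :=
    ne_top_of_le_ne_top (measure_univ_ne_top_of_energy_ne_top hπ hμ) (measure_mono E.subset_univ)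
  simpa using measure_le_dtreeCap_of_energy_le (π := π) (μ := μ.restrict E) (E := E)
    (by simpa using hfin) (by simpa using energy_restrict_le hE hae)

/-- A measure of finite energy does not charge the slices through a boundary point. -/
theorem measure_boundarySlice_eq_zero {π : DVertex d → ℝ≥0} {c : ℝ≥0} (hc : 0 < c)
    (hπ : ∀ β, c ≤ π β) {μ : Measure (ClosedDTree d)} (hμ : energy π μ ≠ ∞) (j : Fin d)
    (ω : ℕ → Bool) : μ (ClosedDTree.boundarySlice j ω) = 0 := by
  by_contra h0
  set m := μ (ClosedDTree.boundarySlice j ω)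
  -- The first `n` letters of `ω` in coordinate `j`, the root elsewhere: distinct vertices whose
  -- successor sets all contain the slice.
  let γ : ℕ → DVertex d := fun n =>
    Function.update (fun _ => []) j (List.ofFn fun i : Fin n => ω i)
  have hγ : Function.Injective γ := by
    intro n k h
    have := congrArg (fun β : DVertex d => (β j).length) h
    simpa [γ] using this
  have hle : ∀ n, m ≤ dualHardy μ (γ n) := by
    refine fun n => measure_mono fun α hα k => ?_
    by_cases hk : k = j
    · subst hk
      rw [hα.1]
      intro i b hb
      simp only [ClosedDTree.vertex, γ, Function.update_self, ClosedTree.letter,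
        List.getElem?_ofFn] at hb ⊢
      split_ifs at hb
      exact hb
    · simp only [ClosedDTree.vertex, γ, Function.update_of_ne hk]
      exact (α k).le_root
  refine hμ (top_le_iff.mp ?_)
  calc (∞ : ℝ≥0∞) = ∑' _ : ℕ, m ^ 2 * c :=
        (ENNReal.tsum_const_eq_top_of_ne_zero (by simp [h0, hc.ne'])).symm
    _ ≤ ∑' n, dualHardy μ (γ n) ^ 2 * π (γ n) := by
        refine ENNReal.tsum_le_tsum fun n => ?_
        gcongr
        · exact hle n
        · exact hπ _
    _ ≤ ∑' β, dualHardy μ β ^ 2 * π β :=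
        ENNReal.tsum_comp_le_tsum_of_injective hγ fun β => dualHardy μ β ^ 2 * (π β : ℝ≥0∞)
    _ = energy π μ := (energy_eq_tsum π μ).symm

end Energy

theorem lemma1 (d : ℕ) (π : DVertex d → ℝ≥0) (hπ : ∃ c : ℝ≥0, 0 < c ∧ ∀ β, c ≤ π β) :
    (∀ μ : Measure (ClosedDTree d),
      μ (ClosedDTree.distinguishedBoundary d)ᶜ = 0 → energy π μ < ∞ →
      ∀ (j : Fin d) (ω : ℕ → Bool), μ (ClosedDTree.boundarySlice j ω) = 0) ∧
    (∀ πc : Fin d → Vertex → ℝ≥0, (∀ β, π β = ∏ j, πc j (β j)) →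
      ∀ E : Set (ClosedDTree d), MeasurableSet E →
        dtreeCap π E ≤ ∏ j, treeCap (πc j) (ClosedDTree.proj j E) ∧
        ∀ F : Fin d → Set ClosedTree, E = ClosedDTree.prodSet F →
          dtreeCap π E = ∏ j, treeCap (πc j) (F j)) ∧
    (∀ (E : Set (ClosedDTree d)) (μ : Measure (ClosedDTree d)), MeasurableSet E →
      energy π μ < ∞ → QAEOn π E (fun α => potential π μ α ≤ 1) → μ E ≤ dtreeCap π E) ∧
    (∀ (E : Set (ClosedDTree d)) (μ : Measure (ClosedDTree d)), MeasurableSet E →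
      IsFiniteMeasure μ → energy π μ ≤ μ E → μ E ≤ dtreeCap π E) := by
  obtain ⟨c, hc, hcπ⟩ := hπ
  have hπ0 : ∀ β, π β ≠ 0 := fun β => (hc.trans_le (hcπ β)).ne'
  refine ⟨fun μ _ hμ j ω => measure_boundarySlice_eq_zero hc hcπ hμ.ne j ω, fun πc hprod E _ => ?_,
    fun E μ hE hμ h => measure_le_dtreeCap_of_potential_le (hπ0 _) hE hμ.ne h,
    fun E μ _ _ h => measure_le_dtreeCap_of_energy_le (measure_ne_top μ E) h⟩
  have hπc : ∀ j v, πc j v ≠ 0 := by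
    intro j v
    -- A nonzero value of `π` at a vertex with `j`-th coordinate `v` makes the factor `πc j v`
    -- nonzero.
    have h := hπ0 (Function.update (fun _ => []) j v)
    rw [hprod, Finset.prod_ne_zero_iff] at h
    simpa using h j (Finset.mem_univ j)
  obtain rfl : π = fun β => ∏ j, πc j (β j) := funext hprod
  exact ⟨dtreeCap_le_prod_proj πc hπc E, fun F hF => hF ▸ dtreeCap_prodSet πc hπc F⟩
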